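/- Theorem. Let $-\infty\le a<b\le\infty$ and let $A:(a,b)\to\mathbb{R}^{n\times n}$ be a matrix of measurable, locally essentially bounded functions (each entry is essentially bounded on every compact subset of $(a,b)$). Call $\Phi$ a transition matrix of the linear system $\dot\Phi=A(t)\Phi$ on $(a,b)$ if for every $t_0\in(a,b)$ the map $t\mapsto\Phi(t,t_0)$ is locally absolutely continuous on $(a,b)$, satisfies $\frac{d}{dt}\Phi(t,t_0)=A(t)\Phi(t,t_0)$ for almost every $t\in(a,b)$, and $\Phi(t_0,t_0)=I$. A real square matrix is totally nonnegative (TN) if the determinant of each of its square submatrices is nonnegative. A transition matrix exists. Moreover, for every transition matrix $\Phi$ of the system, the system is a totally nonnegative differential system on $(a,b)$, that is, $\Phi(t,t_0)$ is TN for all $a<t_0\le t<b$, if and only if for almost every $t\in(a,b)$ the matrix $A(t)$ is tridiagonal with nonnegative entries on the sub- and super-diagonal. -/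

import Mathlib

open MeasureTheory

namespace TotallyNonnegative

/-- The open interval `(a, b)` of real numbers, where `a` and `b` may be infinite. -/
def interval (a b : EReal) : Set ℝ :=
  {t : ℝ | a < (t : EReal) ∧ (t : EReal) < b}

/-- A real square matrix is totally nonnegative if the determinant of every square submatrix
(rows and columns chosen in increasing order) is nonnegative. -/
def IsTN {n : ℕ} (M : Matrix (Fin n) (Fin n) ℝ) : Prop :=
  ∀ (p : ℕ) (r c : Fin p → Fin n), StrictMono r → StrictMono c → 0 ≤ (M.submatrix r c).det

/-- Tridiagonal matrices with nonnegative entries on the sub- and super-diagonal. -/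
def tridiagonalNonneg (n : ℕ) : Set (Matrix (Fin n) (Fin n) ℝ) :=
  {M | (∀ i j : Fin n, 1 < |((i : ℕ) : ℤ) - ((j : ℕ) : ℤ)| → M i j = 0) ∧
    (∀ i j : Fin n, |((i : ℕ) : ℤ) - ((j : ℕ) : ℤ)| = 1 → 0 ≤ M i j)}

/-- `A` is, on `(a, b)`, a matrix of (Lebesgue) measurable, locally essentially bounded functions:
on every compact subset of `(a, b)` each entry is essentially bounded. The values of `A` outside
`(a, b)` play no role. -/
structure IsLocallyEssBounded {n : ℕ} (a b : EReal) (A : ℝ → Matrix (Fin n) (Fin n) ℝ) :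
    Prop where
  measurable : ∀ i j : Fin n, AEMeasurable (fun t => A t i j) (volume.restrict (interval a b))
  bounded : ∀ K : Set ℝ, IsCompact K → K ⊆ interval a b → ∀ i j : Fin n,
    ∃ C : ℝ, ∀ᵐ t ∂(volume.restrict K), |A t i j| ≤ C

/-- `Φ`, with `Φ t t₀` standing for `Φ(t, t₀)`, is a transition matrix of `Φ̇ = A(t) Φ` on `(a, b)`:
for every `t₀` in `(a, b)`, `Φ(t₀, t₀) = I`, and `t ↦ Φ(t, t₀)` is locally absolutely
continuous on `(a, b)` (both before and after `t₀`) and satisfies the differential equation at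
almost every `t`. -/
structure IsTransitionMatrix {n : ℕ} (a b : EReal) (A : ℝ → Matrix (Fin n) (Fin n) ℝ)
    (Φ : ℝ → ℝ → Matrix (Fin n) (Fin n) ℝ) : Prop where
  initial : ∀ t₀ ∈ interval a b, Φ t₀ t₀ = 1
  absolutelyContinuous : ∀ t₀ ∈ interval a b, ∀ c ∈ interval a b, ∀ d ∈ interval a b,
    ∀ i j : Fin n, AbsolutelyContinuousOnInterval (fun t => Φ t t₀ i j) c d
  hasDerivAt : ∀ t₀ ∈ interval a b, ∀ᵐ t ∂(volume.restrict (interval a b)),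
    ∀ i j : Fin n, HasDerivAt (fun s => Φ s t₀ i j) ((A t * Φ t t₀) i j) t

/-- The system with transition matrix `Φ` is a totally nonnegative differential system on
`(a, b)`: `Φ(t, t₀)` is totally nonnegative whenever `a < t₀ ≤ t < b`. -/
def IsTNDS {n : ℕ} (a b : EReal) (Φ : ℝ → ℝ → Matrix (Fin n) (Fin n) ℝ) : Prop :=
  ∀ t₀ ∈ interval a b, ∀ t ∈ interval a b, t₀ ≤ t → IsTN (Φ t t₀)

end TotallyNonnegative

namespace TotallyNonnegative

open Set

/-! ### Absolutely continuous functions and Grönwall's inequality. -/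

section AbsolutelyContinuous

variable {c d : ℝ}

/-! Existence: the Peano-Baker series converges uniformly on compact subintervals, being dominated
by an exponential series.

Sufficiency (`IsTransitionMatrix.isTNDS`): fix `t₀` and a set of `p` columns. By multilinearity, the
derivative of a minor of `Φ(t, t₀)` is a combination of minors in which one row index `r k` is
replaced by some `l`, with weight `A (r k) l`. If `A` is tridiagonal, a replacement with nonzero
weight moves an index by at most one, so the new row sequence is still increasing or has a repeated
row; no reordering sign ever appears. The minors therefore solve a linear system that is nonnegative
off the diagonal. Such a system preserves the nonnegative orthant (`nonneg_of_linear_system`: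
Grönwall for the sum of squared negative parts), and the minors of the identity are 0 or 1.

Necessity (`IsTNDS.ae_mem_tridiagonalNonneg`): for almost every `t`, `Φ(s, t)` is `I + (s - t) A(t)`
to first order. Nonnegative entries give nonnegative off-diagonal `A i j`. If `k` lies strictly
between `i` and `j`, the 2×2 minor containing `Φ i k`, `Φ k j`, `Φ i j`, `Φ k k` has derivative `-A
i j`, so `A i j = 0`. -/

theorem AbsolutelyContinuousOnInterval.congr {f g : ℝ → ℝ}
    (hf : AbsolutelyContinuousOnInterval f c d) (h : EqOn f g (uIcc c d)) :
    AbsolutelyContinuousOnInterval g c d := by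
  rw [absolutelyContinuousOnInterval_iff] at hf ⊢
  intro ε hε
  obtain ⟨δ, hδ, H⟩ := hf ε hε
  refine ⟨δ, hδ, fun E hE hlt => ?_⟩
  have := H E hE hlt
  rwa [Finset.sum_congr rfl fun i hi => by rw [h (hE.1 i hi).1, h (hE.1 i hi).2]] at this

theorem absolutelyContinuousOnInterval_const (x : ℝ) :
    AbsolutelyContinuousOnInterval (fun _ => x) c d :=
  ContDiffOn.absolutelyContinuousOnInterval contDiffOn_const

theorem AbsolutelyContinuousOnInterval.finsetSum {ι : Type*} {s : Finset ι} {f : ι → ℝ → ℝ}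
    (hf : ∀ i ∈ s, AbsolutelyContinuousOnInterval (f i) c d) :
    AbsolutelyContinuousOnInterval (fun t => ∑ i ∈ s, f i t) c d := by
  classical
  induction s using Finset.induction_on with
  | empty => simpa using absolutelyContinuousOnInterval_const 0
  | insert i s hi ih =>
    simp only [Finset.sum_insert hi]
    exact (hf i (by simp)).fun_add (ih fun j hj => hf j (by simp [hj]))

theorem AbsolutelyContinuousOnInterval.finsetProd {ι : Type*} {s : Finset ι} {f : ι → ℝ → ℝ}
    (hf : ∀ i ∈ s, AbsolutelyContinuousOnInterval (f i) c d) :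
    AbsolutelyContinuousOnInterval (fun t => ∏ i ∈ s, f i t) c d := by
  classical
  induction s using Finset.induction_on with
  | empty => simpa using absolutelyContinuousOnInterval_const 1
  | insert i s hi ih =>
    simp only [Finset.prod_insert hi]
    exact (hf i (by simp)).fun_mul (ih fun j hj => hf j (by simp [hj]))

theorem AbsolutelyContinuousOnInterval.det {p : ℕ} {M : ℝ → Matrix (Fin p) (Fin p) ℝ}
    (hM : ∀ i j, AbsolutelyContinuousOnInterval (fun t => M t i j) c d) :
    AbsolutelyContinuousOnInterval (fun t => (M t).det) c d := by
  simp only [Matrix.det_apply, Units.smul_def, zsmul_eq_mul]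
  exact AbsolutelyContinuousOnInterval.finsetSum fun σ _ =>
    AbsolutelyContinuousOnInterval.const_mul _
      (AbsolutelyContinuousOnInterval.finsetProd fun i _ => hM _ _)

theorem AbsolutelyContinuousOnInterval.min_zero {f : ℝ → ℝ}
    (hf : AbsolutelyContinuousOnInterval f c d) :
    AbsolutelyContinuousOnInterval (fun t => min (f t) 0) c d := by
  rw [absolutelyContinuousOnInterval_iff] at hf ⊢
  intro ε hε
  obtain ⟨δ, hδ, H⟩ := hf ε hε
  refine ⟨δ, hδ, fun E hE hlt => (Finset.sum_le_sum fun i _ => ?_).trans_lt (H E hE hlt)⟩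
  simp only [Real.dist_eq]
  exact (abs_min_sub_min_le_max _ _ _ _).trans (by simp)

/-- Squaring removes the kink of the negative part at 0, so the squared negative part of a solution
can be differentiated wherever the solution can. -/
theorem hasDerivAt_sq_min_zero (x : ℝ) : HasDerivAt (fun y => min y 0 ^ 2) (2 * min x 0) x := by
  rcases lt_trichotomy x 0 with h | rfl | h
  · rw [min_eq_left h.le]
    have := (hasDerivAt_pow 2 x)
    refine (this.congr_of_eventuallyEq ?_).congr_deriv (by simp)
    filter_upwards [gt_mem_nhds h] with y hy
    rw [min_eq_left hy.le]
  · rw [hasDerivAt_iff_isLittleO]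
    have : (fun y : ℝ => y ^ 2) =o[nhds 0] fun y => y := by
      simpa using Asymptotics.isLittleO_pow_id (𝕜 := ℝ) one_lt_two
    refine (Asymptotics.IsBigO.of_bound 1 (Filter.Eventually.of_forall fun y => ?_)).trans_isLittleO
      (this.congr_right fun y => by simp)
    have : |min y 0| ≤ |y| := by
      rcases le_total y 0 with h | h <;> simp [h]
    simpa using sq_le_sq' (by linarith [abs_nonneg y, neg_abs_le (min y 0)])
      ((le_abs_self (min y 0)).trans this)
  · rw [min_eq_right h.le]
    refine ((hasDerivAt_const x (0 : ℝ)).congr_of_eventuallyEq ?_).congr_deriv (by simp)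
    filter_upwards [lt_mem_nhds h] with y hy
    rw [min_eq_right (le_of_lt hy)]
    simp

theorem ae_ne_endpoints (c d : ℝ) : ∀ᵐ t : ℝ, t ≠ c ∧ t ≠ d := by
  have h (x : ℝ) : ∀ᵐ t : ℝ, t ≠ x := by simp [ae_iff]
  filter_upwards [h c, h d] with t h1 h2 using ⟨h1, h2⟩

/-- Absolute continuity gives the fundamental theorem of calculus, so the sign of the derivative
matters only almost everywhere. -/
theorem le_of_ae_hasDerivAt_nonpos {V V' : ℝ → ℝ} (hcd : c ≤ d)
    (hV : AbsolutelyContinuousOnInterval V c d)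
    (hV' : ∀ᵐ t, t ∈ Ioo c d → HasDerivAt V (V' t) t ∧ V' t ≤ 0) : V d ≤ V c := by
  rw [← sub_nonpos, ← hV.integral_deriv_eq_sub, intervalIntegral.integral_of_le hcd]
  refine integral_nonpos_of_ae ?_
  rw [Filter.EventuallyLE, ae_restrict_iff' measurableSet_Ioc]
  filter_upwards [hV', ae_ne_endpoints c d] with t ht hne hmem
  obtain ⟨h1, h2⟩ := ht ⟨hmem.1, lt_of_le_of_ne hmem.2 hne.2⟩
  simpa [h1.deriv] using h2

/-- Grönwall's inequality for absolutely continuous functions. -/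
theorem le_exp_mul_of_ae_hasDerivAt_le {V V' : ℝ → ℝ} {K : ℝ} (hcd : c ≤ d)
    (hV : AbsolutelyContinuousOnInterval V c d)
    (hV' : ∀ᵐ t, t ∈ Ioo c d → HasDerivAt V (V' t) t ∧ V' t ≤ K * V t) :
    V d ≤ Real.exp (K * (d - c)) * V c := by
  -- Integrating factor: `exp (-K t) V t` has nonpositive derivative.
  have hE : AbsolutelyContinuousOnInterval (fun t => Real.exp (-(K * t))) c d :=
    ContDiffOn.absolutelyContinuousOnInterval (ContDiff.contDiffOn (by fun_prop))
  have key := le_of_ae_hasDerivAt_nonpos hcd (hE.fun_mul hV)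
    (V' := fun t => Real.exp (-(K * t)) * (V' t - K * V t)) (by
      filter_upwards [hV'] with t ht hmem
      obtain ⟨h1, h2⟩ := ht hmem
      refine ⟨?_, mul_nonpos_of_nonneg_of_nonpos (Real.exp_pos _).le (by linarith)⟩
      have h3 : HasDerivAt (fun t => Real.exp (-(K * t))) (Real.exp (-(K * t)) * -(K * 1)) t :=
        ((hasDerivAt_id t).const_mul K).neg.exp
      exact (h3.mul h1).congr_deriv (by ring))
  have : V d = Real.exp (K * d) * (Real.exp (-(K * d)) * V d) := by
    rw [← mul_assoc, ← Real.exp_add]; simp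
  rw [this]
  refine (mul_le_mul_of_nonneg_left key (Real.exp_pos _).le).trans_eq ?_
  rw [← mul_assoc, ← Real.exp_add]
  ring_nf

end AbsolutelyContinuous

/-! ### Linear systems with bounded coefficients: uniqueness and positivity. -/

section LinearSystem

variable {ι : Type*} [Fintype ι] {c d : ℝ}

theorem sum_sum_sq_add_sq (x : ι → ℝ) (C : ℝ) :
    ∑ i, ∑ j, C * (x i ^ 2 + x j ^ 2) = 2 * Fintype.card ι * C * ∑ i, x i ^ 2 := by
  simp only [← Finset.mul_sum, Finset.sum_add_distrib, Finset.sum_const, Finset.card_univ,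
    nsmul_eq_mul]
  ring

/-- Apply `2 |x i| |x j| ≤ x i ^ 2 + x j ^ 2` to each term. The left side is the derivative of `∑ x
i ^ 2` along the system, so this is the input to Grönwall. -/
theorem abs_sum_mul_mul_le {x : ι → ℝ} {M : ι → ι → ℝ} {C : ℝ} (hM : ∀ i j, |M i j| ≤ C) :
    |∑ i, 2 * x i * ∑ j, M i j * x j| ≤ 2 * Fintype.card ι * C * ∑ i, x i ^ 2 := by
  rw [← sum_sum_sq_add_sq]
  refine (Finset.abs_sum_le_sum_abs _ _).trans (Finset.sum_le_sum fun i _ => ?_)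
  rw [Finset.mul_sum]
  refine (Finset.abs_sum_le_sum_abs _ _).trans (Finset.sum_le_sum fun j _ => ?_)
  have h1 : |2 * x i * (M i j * x j)| = |M i j| * (2 * |x i| * |x j|) := by
    simp only [abs_mul, abs_two]; ring
  rw [h1, ← sq_abs (x i), ← sq_abs (x j)]
  exact mul_le_mul (hM i j) (by nlinarith [sq_nonneg (|x i| - |x j|)]) (by positivity)
    ((abs_nonneg _).trans (hM i j))

/-- A solution of a linear system with bounded coefficients that vanishes at one end of an
interval vanishes at the other. -/
theorem eq_zero_iff_of_linear_system {M : ℝ → ι → ι → ℝ} {x : ℝ → ι → ℝ} {C : ℝ} (hcd : c ≤ d)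
    (hx : ∀ i, AbsolutelyContinuousOnInterval (fun t => x t i) c d)
    (hM : ∀ᵐ t, t ∈ Ioo c d → ∀ i j, |M t i j| ≤ C)
    (hd : ∀ᵐ t, t ∈ Ioo c d → ∀ i, HasDerivAt (fun s => x s i) (∑ j, M t i j * x t j) t) :
    x c = 0 ↔ x d = 0 := by
  set V : ℝ → ℝ := fun t => ∑ i, x t i ^ 2 with hVdef
  have hV0 : ∀ t, x t = 0 ↔ V t ≤ 0 := fun t => by
    constructor
    · intro h; simp [V, h]
    · intro h
      have h0 : V t = 0 := le_antisymm h (Finset.sum_nonneg fun i _ => sq_nonneg _)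
      rw [hVdef] at h0
      ext i
      have := (Finset.sum_eq_zero_iff_of_nonneg fun i _ => sq_nonneg (x t i)).1 h0 i
        (Finset.mem_univ i)
      simpa using this
  have hVac : AbsolutelyContinuousOnInterval V c d :=
    AbsolutelyContinuousOnInterval.finsetSum fun i _ => by
      simpa only [sq] using (hx i).fun_mul (hx i)
  have hVd : ∀ᵐ t, t ∈ Ioo c d → HasDerivAt V (∑ i, 2 * x t i * ∑ j, M t i j * x t j) t ∧
      |∑ i, 2 * x t i * ∑ j, M t i j * x t j| ≤ 2 * Fintype.card ι * C * V t := by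
    filter_upwards [hM, hd] with t h1 h2 hmem
    exact ⟨HasDerivAt.fun_sum fun i _ => ((h2 hmem i).fun_pow 2).congr_deriv (by simp),
      abs_sum_mul_mul_le (h1 hmem)⟩
  rw [hV0, hV0]
  constructor <;> intro h
  · refine (le_exp_mul_of_ae_hasDerivAt_le hcd hVac (V' := fun t =>
      ∑ i, 2 * x t i * ∑ j, M t i j * x t j) (K := 2 * Fintype.card ι * C) ?_).trans
      (mul_nonpos_of_nonneg_of_nonpos (Real.exp_pos _).le h)
    filter_upwards [hVd] with t ht hmem
    exact ⟨(ht hmem).1, (le_abs_self _).trans (ht hmem).2⟩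
  -- Backward uniqueness: the lower bound `V' ≥ -K V` is Grönwall's hypothesis for `-V` with
  -- constant `-K`, and bounds `V c` by a multiple of `V d`.
  · have key := le_exp_mul_of_ae_hasDerivAt_le hcd hVac.fun_neg (V' := fun t =>
      -∑ i, 2 * x t i * ∑ j, M t i j * x t j) (K := -(2 * Fintype.card ι * C)) (by
        filter_upwards [hVd] with t ht hmem
        refine ⟨(ht hmem).1.fun_neg, ?_⟩
        have := (neg_le_abs _).trans (ht hmem).2
        linarith)
    have h2 := Real.exp_pos (-(2 * Fintype.card ι * C) * (d - c))
    by_contra! h3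
    nlinarith [mul_pos h2 h3]

/-- A system whose coefficients are nonnegative off the diagonal preserves nonnegativity. -/
theorem nonneg_of_linear_system {M : ℝ → ι → ι → ℝ} {x : ℝ → ι → ℝ} {C : ℝ} (hcd : c ≤ d)
    (hx : ∀ i, AbsolutelyContinuousOnInterval (fun t => x t i) c d)
    (hM : ∀ᵐ t, t ∈ Ioo c d → ∀ i j, |M t i j| ≤ C)
    (hoff : ∀ᵐ t, t ∈ Ioo c d → ∀ i j, i ≠ j → 0 ≤ M t i j)
    (hd : ∀ᵐ t, t ∈ Ioo c d → ∀ i, HasDerivAt (fun s => x s i) (∑ j, M t i j * x t j) t)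
    (hc : ∀ i, 0 ≤ x c i) (i : ι) : 0 ≤ x d i := by
  set V : ℝ → ℝ := fun t => ∑ i, min (x t i) 0 ^ 2 with hVdef
  have hVac : AbsolutelyContinuousOnInterval V c d :=
    AbsolutelyContinuousOnInterval.finsetSum fun i _ => by
      simpa only [sq] using
        (AbsolutelyContinuousOnInterval.min_zero (hx i)).fun_mul
          (AbsolutelyContinuousOnInterval.min_zero (hx i))
  have key := le_exp_mul_of_ae_hasDerivAt_le hcd hVac (K := 2 * Fintype.card ι * C)
    (V' := fun t => ∑ i, 2 * min (x t i) 0 * ∑ j, M t i j * x t j) (by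
      filter_upwards [hM, hoff, hd] with t h1 h2 h3 hmem
      refine ⟨HasDerivAt.fun_sum fun i _ =>
        HasDerivAt.comp t (h₂ := fun y => min y 0 ^ 2) (h := fun s => x s i)
          (hasDerivAt_sq_min_zero (x t i)) (h3 hmem i), ?_⟩
      -- Replacing `x j` by its negative part can only increase the sum: off the diagonal `M i j ≥
      -- 0` and `min (x i) 0 ≤ 0`, and on the diagonal nothing changes.
      refine le_trans ?_ ((le_abs_self _).trans
        (abs_sum_mul_mul_le (x := fun i => min (x t i) 0) (h1 hmem)))
      refine Finset.sum_le_sum fun i _ => ?_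
      simp only [mul_assoc, Finset.mul_sum]
      refine Finset.sum_le_sum fun j _ => mul_le_mul_of_nonneg_left ?_ zero_le_two
      by_cases hij : i = j
      · subst hij
        rcases le_total (x t i) 0 with h | h <;> simp [h]
      · have h4 := h2 hmem i j hij
        have h5 : min (x t i) 0 ≤ 0 := min_le_right _ _
        have h6 : min (x t j) 0 ≤ x t j := min_le_left _ _
        exact mul_le_mul_of_nonpos_left (mul_le_mul_of_nonneg_left h6 h4) h5)
  have hVc : V c = 0 := by simp [V, hc]
  rw [hVc, mul_zero] at key
  have h0 : V d = 0 := le_antisymm key (Finset.sum_nonneg fun i _ => sq_nonneg _)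
  have := (Finset.sum_eq_zero_iff_of_nonneg fun i _ => sq_nonneg (min (x d i) 0)).1 h0 i
    (Finset.mem_univ i)
  simpa using this

end LinearSystem

/-! ### The interval `(a, b)` and almost-everywhere statements on it. -/

section Interval

theorem mem_interval_of_mem_Icc {a b : EReal} {c d t : ℝ} (hc : c ∈ interval a b)
    (hd : d ∈ interval a b) (ht : t ∈ Icc c d) : t ∈ interval a b :=
  ⟨hc.1.trans_le (EReal.coe_le_coe_iff.2 ht.1), (EReal.coe_le_coe_iff.2 ht.2).trans_lt hd.2⟩

theorem isOpen_interval (a b : EReal) : IsOpen (interval a b) :=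
  (isOpen_Ioo (a := a) (b := b)).preimage continuous_coe_real_ereal

theorem interval_nonempty {a b : EReal} (hab : a < b) : (interval a b).Nonempty := by
  obtain ⟨q, h1, h2⟩ := EReal.lt_iff_exists_real_btwn.1 hab
  exact ⟨q, h1, h2⟩

theorem exists_Ioo_of_mem_interval {a b : EReal} {t : ℝ} (ht : t ∈ interval a b) :
    ∃ c ∈ interval a b, ∃ d ∈ interval a b, t ∈ Ioo c d := by
  obtain ⟨c, h1, h2⟩ := EReal.lt_iff_exists_real_btwn.1 ht.1
  obtain ⟨d, h3, h4⟩ := EReal.lt_iff_exists_real_btwn.1 ht.2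
  rw [EReal.coe_lt_coe_iff] at h2 h3
  exact ⟨c, ⟨h1, (EReal.coe_lt_coe_iff.2 h2).trans ht.2⟩, d,
    ⟨ht.1.trans (EReal.coe_lt_coe_iff.2 h3), h4⟩, h2, h3⟩

/-- Being null is a local property, so it suffices to work on bounded subintervals with endpoints
inside `(a, b)`, where `A` has a uniform bound. -/
theorem ae_interval_iff {a b : EReal} {p : ℝ → Prop} :
    (∀ᵐ t ∂volume.restrict (interval a b), p t) ↔
      ∀ c ∈ interval a b, ∀ d ∈ interval a b, ∀ᵐ t, t ∈ Ioo c d → p t := by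
  rw [ae_restrict_iff' (isOpen_interval a b).measurableSet]
  constructor
  · intro h c hc d hd
    filter_upwards [h] with t ht hmem
    exact ht (mem_interval_of_mem_Icc hc hd (Ioo_subset_Icc_self hmem))
  · intro h
    rw [ae_iff]
    refine measure_null_of_locally_null _ fun t ht => ?_
    simp only [mem_ofPred_eq, Classical.not_imp] at ht
    obtain ⟨c, hc, d, hd, hmem⟩ := exists_Ioo_of_mem_interval ht.1
    refine ⟨_, inter_mem_nhdsWithin _ (Ioo_mem_nhds hmem.1 hmem.2),
      measure_mono_null ?_ (ae_iff.1 (h c hc d hd))⟩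
    rintro s ⟨hs, hs'⟩
    simp only [mem_ofPred_eq, Classical.not_imp] at hs ⊢
    exact ⟨hs', hs.2⟩

end Interval

theorem IsLocallyEssBounded.exists_bound {n : ℕ} {a b : EReal} {A : ℝ → Matrix (Fin n) (Fin n) ℝ}
    (hA : IsLocallyEssBounded a b A) {c d : ℝ} (hc : c ∈ interval a b) (hd : d ∈ interval a b) :
    ∃ C : ℝ, 0 ≤ C ∧ ∀ᵐ t, t ∈ Icc c d → ∀ i j, |A t i j| ≤ C := by
  have h := hA.bounded (Icc c d) isCompact_Icc fun t ht => mem_interval_of_mem_Icc hc hd ht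
  choose C hC using h
  refine ⟨∑ i, ∑ j, |C i j|, by positivity, ?_⟩
  have h2 : ∀ᵐ t ∂(volume.restrict (Icc c d)), ∀ i j, |A t i j| ≤ C i j :=
    ae_all_iff.2 fun i => ae_all_iff.2 fun j => hC i j
  rw [ae_restrict_iff' measurableSet_Icc] at h2
  filter_upwards [h2] with t ht hmem i j
  calc |A t i j| ≤ |C i j| := (ht hmem i j).trans (le_abs_self _)
    _ ≤ ∑ j, |C i j| :=
      Finset.single_le_sum (f := fun j => |C i j|) (fun j _ => abs_nonneg _) (Finset.mem_univ j)
    _ ≤ ∑ i, ∑ j, |C i j| :=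
      Finset.single_le_sum (f := fun i => ∑ j, |C i j|)
        (fun i _ => Finset.sum_nonneg fun j _ => abs_nonneg _) (Finset.mem_univ i)

theorem IsLocallyEssBounded.intervalIntegrable {n : ℕ} {a b : EReal}
    {A : ℝ → Matrix (Fin n) (Fin n) ℝ} (hA : IsLocallyEssBounded a b A) {c d : ℝ} (hcd : c ≤ d)
    (hc : c ∈ interval a b) (hd : d ∈ interval a b) (i j : Fin n) :
    IntervalIntegrable (fun t => A t i j) volume c d := by
  obtain ⟨C, -, hC⟩ := hA.exists_bound hc hd
  rw [intervalIntegrable_iff, uIoc_of_le hcd]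
  refine Integrable.of_bound ?_ C ?_
  · exact ((hA.measurable i j).mono_set fun t ht =>
      mem_interval_of_mem_Icc hc hd (Ioc_subset_Icc_self ht)).aestronglyMeasurable
  · rw [ae_restrict_iff' measurableSet_Ioc]
    filter_upwards [hC] with t ht hmem
    exact ht (Ioc_subset_Icc_self hmem) i j

/-! ### Existence by the Peano-Baker series. -/

section Picard

variable {n : ℕ}

/-- The terms of the Peano-Baker series of `x' = A(t) x`, `x(t₀) = x₀`. -/
noncomputable def peanoBaker (A : ℝ → Matrix (Fin n) (Fin n) ℝ) (t₀ : ℝ) (x₀ : Fin n → ℝ) :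
    ℕ → ℝ → Fin n → ℝ
  | 0, _, i => x₀ i
  | k + 1, t, i => ∫ s in t₀..t, ∑ l, A s i l * peanoBaker A t₀ x₀ k s l

variable {A : ℝ → Matrix (Fin n) (Fin n) ℝ} {t₀ c d C : ℝ} {x₀ : Fin n → ℝ}

theorem intervalIntegrable_sum_mul {x : ℝ → Fin n → ℝ} (hcd : c ≤ d)
    (hA : ∀ i j, IntervalIntegrable (fun t => A t i j) volume c d)
    (hx : ∀ i, ContinuousOn (fun t => x t i) (Icc c d)) (i : Fin n) :
    IntervalIntegrable (fun s => ∑ l, A s i l * x s l) volume c d := by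
  have := IntervalIntegrable.sum Finset.univ (f := fun l s => A s i l * x s l) fun l _ =>
    (hA i l).mul_continuousOn (by rw [uIcc_of_le hcd]; exact hx l)
  simpa only [Finset.sum_fn] using this

theorem continuousOn_peanoBaker (ht₀ : t₀ ∈ Icc c d)
    (hA : ∀ i j, IntervalIntegrable (fun t => A t i j) volume c d) (k : ℕ) (i : Fin n) :
    ContinuousOn (fun t => peanoBaker A t₀ x₀ k t i) (Icc c d) := by
  have hcd := ht₀.1.trans ht₀.2
  induction k generalizing i with
  | zero => exact continuousOn_const
  | succ k ih =>
    rw [← uIcc_of_le hcd] at ht₀ ⊢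
    exact ((intervalIntegrable_sum_mul hcd hA ih i).absolutelyContinuousOnInterval_intervalIntegral
      ht₀).continuousOn

/-- Each integration contributes a factor `n * C * |t - t₀| / (k + 1)`, which builds the terms of an
exponential series. -/
theorem abs_peanoBaker_le (ht₀ : t₀ ∈ Icc c d)
    (hA : ∀ i j, IntervalIntegrable (fun t => A t i j) volume c d) (hC0 : 0 ≤ C)
    (hC : ∀ᵐ t, t ∈ Icc c d → ∀ i j, |A t i j| ≤ C) (k : ℕ) {t : ℝ} (ht : t ∈ Icc c d)
    (i : Fin n) :
    |peanoBaker A t₀ x₀ k t i| ≤ (∑ i, |x₀ i|) * ((n * C) ^ k * |t - t₀| ^ k / k.factorial) := by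
  have hcd := ht₀.1.trans ht₀.2
  induction k generalizing i t with
  | zero =>
    simpa [peanoBaker] using
      Finset.single_le_sum (f := fun i => |x₀ i|) (fun i _ => abs_nonneg _) (Finset.mem_univ i)
  | succ k ih =>
    set m := ∑ i, |x₀ i| with hm
    have hm0 : 0 ≤ m := Finset.sum_nonneg fun i _ => abs_nonneg _
    have hsub : uIoc t₀ t ⊆ Icc c d :=
      uIoc_subset_uIcc.trans (uIcc_subset_Icc ht₀ ht)
    have hcont : ContinuousOn (fun s => |s - t₀| ^ k) (uIcc t₀ t) := by fun_prop
    have hint : IntegrableOn (fun s => m * (n * C) ^ (k + 1) / k.factorial * |s - t₀| ^ k)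
        (uIoc t₀ t) := by
      rw [← intervalIntegrable_iff]
      exact hcont.intervalIntegrable.const_mul _
    have h1 : IntegrableOn (fun s => ∑ l, A s i l * peanoBaker A t₀ x₀ k s l) (uIoc t₀ t) := by
      rw [← intervalIntegrable_iff]
      refine (intervalIntegrable_sum_mul hcd hA
        (continuousOn_peanoBaker ht₀ hA k) i).mono_set ?_
      rw [uIcc_of_le hcd]
      exact uIcc_subset_Icc ht₀ ht
    calc |peanoBaker A t₀ x₀ (k + 1) t i|
        ≤ ∫ s in uIoc t₀ t, |∑ l, A s i l * peanoBaker A t₀ x₀ k s l| :=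
          intervalIntegral.norm_integral_le_integral_norm_uIoc (μ := volume)
            (f := fun s => ∑ l, A s i l * peanoBaker A t₀ x₀ k s l)
      _ ≤ ∫ s in uIoc t₀ t, m * (n * C) ^ (k + 1) / k.factorial * |s - t₀| ^ k := by
          refine integral_mono_ae h1.abs hint ?_
          rw [Filter.EventuallyLE, ae_restrict_iff' measurableSet_uIoc]
          filter_upwards [hC] with s hs hmem
          have h2 : ∀ l, |A s i l * peanoBaker A t₀ x₀ k s l| ≤
              C * (m * ((n * C) ^ k * |s - t₀| ^ k / k.factorial)) := fun l => by
            rw [abs_mul]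
            exact mul_le_mul (hs (hsub hmem) i l) (ih (hsub hmem) l) (abs_nonneg _) hC0
          refine (Finset.abs_sum_le_sum_abs _ _).trans
            ((Finset.sum_le_sum fun l _ => h2 l).trans_eq ?_)
          simp only [Finset.sum_const, Finset.card_univ, Fintype.card_fin, nsmul_eq_mul]
          ring
      _ = m * ((n * C) ^ (k + 1) * |t - t₀| ^ (k + 1) / (k + 1).factorial) := by
          rw [integral_const_mul, integral_pow_abs_sub_uIoc, Nat.factorial_succ]
          push_cast
          field_simp

theorem abs_peanoBaker_le_of_mem (ht₀ : t₀ ∈ Icc c d)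
    (hA : ∀ i j, IntervalIntegrable (fun t => A t i j) volume c d) (hC0 : 0 ≤ C)
    (hC : ∀ᵐ t, t ∈ Icc c d → ∀ i j, |A t i j| ≤ C) (k : ℕ) {t : ℝ} (ht : t ∈ Icc c d)
    (i : Fin n) :
    |peanoBaker A t₀ x₀ k t i| ≤
      (∑ i, |x₀ i|) * ((n * C * (d - c)) ^ k / k.factorial) := by
  refine (abs_peanoBaker_le ht₀ hA hC0 hC k ht i).trans ?_
  rw [← mul_pow]
  have : |t - t₀| ≤ d - c := abs_sub_le_iff.2 ⟨by linarith [ht.2, ht₀.1], by linarith [ht.1, ht₀.2]⟩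
  gcongr

/-- The sum of the Peano-Baker series. -/
noncomputable def peanoBakerSum (A : ℝ → Matrix (Fin n) (Fin n) ℝ) (t₀ : ℝ) (x₀ : Fin n → ℝ)
    (t : ℝ) (i : Fin n) : ℝ := ∑' k, peanoBaker A t₀ x₀ k t i

theorem continuousOn_peanoBakerSum (ht₀ : t₀ ∈ Icc c d)
    (hA : ∀ i j, IntervalIntegrable (fun t => A t i j) volume c d) (hC0 : 0 ≤ C)
    (hC : ∀ᵐ t, t ∈ Icc c d → ∀ i j, |A t i j| ≤ C) (i : Fin n) :
    ContinuousOn (fun t => peanoBakerSum A t₀ x₀ t i) (Icc c d) :=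
  continuousOn_tsum (fun k => continuousOn_peanoBaker ht₀ hA k i)
    ((Real.summable_pow_div_factorial (n * C * (d - c))).mul_left (∑ i, |x₀ i|))
    fun k _ ht => abs_peanoBaker_le_of_mem ht₀ hA hC0 hC k ht i

/-- Integrate the series term by term, by dominated convergence; the recursion shifts the index by
one and leaves the zeroth term `x₀ i` outside. -/
theorem peanoBakerSum_eq (ht₀ : t₀ ∈ Icc c d)
    (hA : ∀ i j, IntervalIntegrable (fun t => A t i j) volume c d) (hC0 : 0 ≤ C)
    (hC : ∀ᵐ t, t ∈ Icc c d → ∀ i j, |A t i j| ≤ C) {t : ℝ} (ht : t ∈ Icc c d) (i : Fin n) :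
    peanoBakerSum A t₀ x₀ t i =
      x₀ i + ∫ s in t₀..t, ∑ l, A s i l * peanoBakerSum A t₀ x₀ s l := by
  have hcd := ht₀.1.trans ht₀.2
  have hbs : Summable fun k : ℕ => (∑ i, |x₀ i|) * ((n * C * (d - c)) ^ k / k.factorial) :=
    (Real.summable_pow_div_factorial (n * C * (d - c))).mul_left (∑ i, |x₀ i|)
  have hsum : ∀ s ∈ Icc c d, ∀ l, Summable fun k => peanoBaker A t₀ x₀ k s l := fun s hs l =>
    Summable.of_norm_bounded hbs fun k => abs_peanoBaker_le_of_mem ht₀ hA hC0 hC k hs l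
  have hsub : uIoc t₀ t ⊆ Icc c d := uIoc_subset_uIcc.trans (uIcc_subset_Icc ht₀ ht)
  have key : HasSum (fun k => peanoBaker A t₀ x₀ (k + 1) t i)
      (∫ s in t₀..t, ∑ l, A s i l * peanoBakerSum A t₀ x₀ s l) := by
    refine intervalIntegral.hasSum_integral_of_dominated_convergence
      (fun k _ => n * (C * ((∑ i, |x₀ i|) * ((n * C * (d - c)) ^ k / k.factorial))))
      (fun k => ?_) (fun k => ?_) ?_ ?_ ?_
    · refine (intervalIntegrable_iff.1 ((intervalIntegrable_sum_mul hcd hA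
        (continuousOn_peanoBaker ht₀ hA k) i).mono_set ?_)).aestronglyMeasurable
      rw [uIcc_of_le hcd]
      exact uIcc_subset_Icc ht₀ ht
    · filter_upwards [hC] with s hs hmem
      refine (Finset.abs_sum_le_sum_abs _ _).trans ((Finset.sum_le_sum (g := fun _ =>
        C * ((∑ i, |x₀ i|) * ((n * C * (d - c)) ^ k / k.factorial))) fun l _ => ?_).trans_eq ?_)
      · rw [abs_mul]
        exact mul_le_mul (hs (hsub hmem) i l)
          (abs_peanoBaker_le_of_mem ht₀ hA hC0 hC k (hsub hmem) l) (abs_nonneg _) hC0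
      · simp only [Finset.sum_const, Finset.card_univ, Fintype.card_fin, nsmul_eq_mul]
    · exact Filter.Eventually.of_forall fun s _ => (hbs.mul_left C).mul_left _
    · exact intervalIntegrable_const
    · refine Filter.Eventually.of_forall fun s hs => hasSum_sum fun l _ => ?_
      exact (hsum s (hsub hs) l).hasSum.mul_left _
  rw [peanoBakerSum, (hsum t ht i).tsum_eq_zero_add, key.tsum_eq]
  rfl

theorem absolutelyContinuousOnInterval_peanoBakerSum (ht₀ : t₀ ∈ Icc c d)
    (hA : ∀ i j, IntervalIntegrable (fun t => A t i j) volume c d) (hC0 : 0 ≤ C)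
    (hC : ∀ᵐ t, t ∈ Icc c d → ∀ i j, |A t i j| ≤ C) (i : Fin n) :
    AbsolutelyContinuousOnInterval (fun t => peanoBakerSum A t₀ x₀ t i) c d := by
  have hcd := ht₀.1.trans ht₀.2
  have hint := intervalIntegrable_sum_mul hcd hA
    (fun i => continuousOn_peanoBakerSum (x₀ := x₀) ht₀ hA hC0 hC i) i
  refine AbsolutelyContinuousOnInterval.congr
    ((absolutelyContinuousOnInterval_const (x₀ i)).fun_add
      (hint.absolutelyContinuousOnInterval_intervalIntegral (by rwa [uIcc_of_le hcd]))) ?_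
  rw [uIcc_of_le hcd]
  exact fun t ht => (peanoBakerSum_eq ht₀ hA hC0 hC ht i).symm

theorem ae_hasDerivAt_peanoBakerSum (ht₀ : t₀ ∈ Icc c d)
    (hA : ∀ i j, IntervalIntegrable (fun t => A t i j) volume c d) (hC0 : 0 ≤ C)
    (hC : ∀ᵐ t, t ∈ Icc c d → ∀ i j, |A t i j| ≤ C) (i : Fin n) :
    ∀ᵐ t, t ∈ Ioo c d → HasDerivAt (fun s => peanoBakerSum A t₀ x₀ s i)
      (∑ l, A t i l * peanoBakerSum A t₀ x₀ t l) t := by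
  have hcd := ht₀.1.trans ht₀.2
  have hint := intervalIntegrable_sum_mul hcd hA
    (fun i => continuousOn_peanoBakerSum (x₀ := x₀) ht₀ hA hC0 hC i) i
  filter_upwards [hint.ae_hasDerivAt_integral] with t ht hmem
  rw [uIcc_of_le hcd] at ht
  refine ((ht (Ioo_subset_Icc_self hmem) t₀ ht₀).const_add (x₀ i)).congr_of_eventuallyEq ?_
  filter_upwards [Ioo_mem_nhds hmem.1 hmem.2] with s hs
  exact peanoBakerSum_eq ht₀ hA hC0 hC (Ioo_subset_Icc_self hs) i

theorem peanoBakerSum_self (i : Fin n) : peanoBakerSum A t₀ x₀ t₀ i = x₀ i := by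
  rw [peanoBakerSum, tsum_eq_single 0]
  · rfl
  · intro k hk
    obtain ⟨k, rfl⟩ := Nat.exists_eq_succ_of_ne_zero hk
    simp [peanoBaker]

end Picard

theorem min_mem_interval {a b : EReal} {c d : ℝ} (hc : c ∈ interval a b) (hd : d ∈ interval a b) :
    min c d ∈ interval a b := by rcases min_choice c d with h | h <;> rwa [h]

theorem max_mem_interval {a b : EReal} {c d : ℝ} (hc : c ∈ interval a b) (hd : d ∈ interval a b) :
    max c d ∈ interval a b := by rcases max_choice c d with h | h <;> rwa [h]

theorem exists_isTransitionMatrix {n : ℕ} {a b : EReal} {A : ℝ → Matrix (Fin n) (Fin n) ℝ}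
    (hA : IsLocallyEssBounded a b A) :
    ∃ Φ : ℝ → ℝ → Matrix (Fin n) (Fin n) ℝ, IsTransitionMatrix a b A Φ := by
  refine ⟨fun t t₀ => Matrix.of fun i j => peanoBakerSum A t₀ (fun i => if i = j then 1 else 0) t i,
    ?_, ?_, ?_⟩
  · intro t₀ _
    ext i j
    simp [peanoBakerSum_self, Matrix.one_apply]
  · intro t₀ ht₀ c hc d hd i j
    -- The series estimates need `t₀` in the interval, so `[c, d]` is enlarged to contain it.
    have hc' := min_mem_interval ht₀ (min_mem_interval hc hd)
    have hd' := max_mem_interval ht₀ (max_mem_interval hc hd)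
    have hmem : t₀ ∈ Icc (min t₀ (min c d)) (max t₀ (max c d)) := by simp
    obtain ⟨C, hC0, hC⟩ := hA.exists_bound hc' hd'
    have hcd := hmem.1.trans hmem.2
    refine (absolutelyContinuousOnInterval_peanoBakerSum hmem
      (hA.intervalIntegrable hcd hc' hd') hC0 hC i).mono ?_
    rw [uIcc_of_le hcd]
    exact Icc_subset_Icc (min_le_right _ _) (le_max_right _ _)
  · intro t₀ ht₀
    rw [ae_interval_iff]
    intro c hc d hd
    have hc' := min_mem_interval ht₀ hc
    have hd' := max_mem_interval ht₀ hd
    have hmem : t₀ ∈ Icc (min t₀ c) (max t₀ d) := by simp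
    obtain ⟨C, hC0, hC⟩ := hA.exists_bound hc' hd'
    have hcd := hmem.1.trans hmem.2
    have h : ∀ᵐ t, ∀ i j, t ∈ Ioo (min t₀ c) (max t₀ d) → _ := ae_all_iff.2 fun i =>
      ae_all_iff.2 fun j => ae_hasDerivAt_peanoBakerSum (x₀ := fun i => if i = j then 1 else 0)
        hmem (hA.intervalIntegrable hcd hc' hd') hC0 hC i
    filter_upwards [h] with t ht htm i j
    exact ht i j (Ioo_subset_Ioo (min_le_right _ _) (le_max_right _ _) htm)

/-! ### Minors as solutions of a linear system; sufficiency. -/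

theorem hasDerivAt_det {p : ℕ} {M : ℝ → Matrix (Fin p) (Fin p) ℝ} {M' : Matrix (Fin p) (Fin p) ℝ}
    {t : ℝ} (hM : ∀ i j, HasDerivAt (fun s => M s i j) (M' i j) t) :
    HasDerivAt (fun s => (M s).det) (∑ k, ((M t).updateRow k (M' k)).det) t := by
  let f : ContinuousMultilinearMap ℝ (fun _ : Fin p => Fin p → ℝ) ℝ :=
    { (Matrix.detRowAlternating : (Fin p → ℝ) [⋀^Fin p]→ₗ[ℝ] ℝ).toMultilinearMap with
      cont := Continuous.matrix_det continuous_id }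
  have h1 : HasDerivAt (fun s => (M s : Fin p → Fin p → ℝ)) M' t :=
    hasDerivAt_pi.2 fun i => hasDerivAt_pi.2 fun j => hM i j
  refine ((f.hasFDerivAt (M t)).comp_hasDerivAt t h1).congr_deriv ?_
  exact ContinuousMultilinearMap.linearDeriv_apply f (M t) M'

theorem det_updateRow_submatrix {n p : ℕ} (A X : Matrix (Fin n) (Fin n) ℝ) (r c : Fin p → Fin n)
    (k : Fin p) :
    ((X.submatrix r c).updateRow k (((A * X).submatrix r c) k)).det =
      ∑ l, A (r k) l * (X.submatrix (Function.update r k l) c).det := by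
  have h1 : ((A * X).submatrix r c) k = ∑ l, A (r k) l • fun j => X l (c j) := by
    ext j
    simp [Matrix.mul_apply]
  have h2 : ∀ l, (X.submatrix r c).updateRow k (fun j => X l (c j)) =
      X.submatrix (Function.update r k l) c := fun l => by
    ext i j
    by_cases h : i = k
    · subst h; simp
    · simp [h]
  rw [h1]
  refine ((Matrix.detRowAlternating : (Fin p → ℝ) [⋀^Fin p]→ₗ[ℝ] ℝ).map_update_sum
    Finset.univ k _ _).trans (Finset.sum_congr rfl fun l _ => ?_)
  refine (Matrix.det_updateRow_smul _ _ _ _).trans ?_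
  rw [h2]

/-- Moving one index of an increasing sequence to a neighbouring value leaves the sequence
increasing unless it creates a repetition. -/
theorem strictMono_update_or_exists_eq {n p : ℕ} {r : Fin p → Fin n} (hr : StrictMono r)
    (k : Fin p) (l : Fin n) (hl : |((r k : ℕ) : ℤ) - ((l : ℕ) : ℤ)| ≤ 1) :
    StrictMono (Function.update r k l) ∨ ∃ k', k' ≠ k ∧ r k' = l := by
  by_cases h : ∃ k', k' ≠ k ∧ r k' = l
  · exact Or.inr h
  · left
    push Not at h
    rw [abs_le] at hl
    intro i j hij
    have hrij : (r i : ℕ) < r j := hr hij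
    rcases eq_or_ne i k with rfl | hi
    · have h1 : (r j : ℕ) ≠ l := fun e => h j hij.ne' (Fin.ext e)
      rw [Function.update_self, Function.update_of_ne hij.ne', Fin.lt_def]
      omega
    · rcases eq_or_ne j k with rfl | hj
      · have h1 : (r i : ℕ) ≠ l := fun e => h i hij.ne (Fin.ext e)
        rw [Function.update_self, Function.update_of_ne hij.ne, Fin.lt_def]
        omega
      · rw [Function.update_of_ne hi, Function.update_of_ne hj]
        exact hr hij

/-- The coefficients of the linear system satisfied by the minors of a solution. -/
noncomputable def minorCoeff {n p : ℕ} (A : Matrix (Fin n) (Fin n) ℝ)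
    (r r' : {r : Fin p → Fin n // StrictMono r}) : ℝ :=
  ∑ k, ∑ l, if Function.update r.1 k l = r'.1 then A (r.1 k) l else 0

theorem abs_minorCoeff_le {n p : ℕ} {A : Matrix (Fin n) (Fin n) ℝ} {C : ℝ}
    (hA : ∀ i j, |A i j| ≤ C) (hC : 0 ≤ C) (r r' : {r : Fin p → Fin n // StrictMono r}) :
    |minorCoeff A r r'| ≤ p * (n * C) := by
  refine (Finset.abs_sum_le_sum_abs _ _).trans ((Finset.sum_le_sum (g := fun _ => n * C)
    fun k _ => ?_).trans_eq (by simp))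
  refine (Finset.abs_sum_le_sum_abs _ _).trans ((Finset.sum_le_sum (g := fun _ => C)
    fun l _ => ?_).trans_eq (by simp))
  split_ifs
  · exact hA _ _
  · simpa using hC

theorem nonneg_of_mem_tridiagonalNonneg {n : ℕ} {A : Matrix (Fin n) (Fin n) ℝ}
    (hA : A ∈ tridiagonalNonneg n) {i j : Fin n} (hij : i ≠ j) : 0 ≤ A i j := by
  have h0 : ((i : ℕ) : ℤ) - ((j : ℕ) : ℤ) ≠ 0 := fun h => hij (Fin.ext (by omega))
  have h1 : 1 ≤ |((i : ℕ) : ℤ) - ((j : ℕ) : ℤ)| := Int.one_le_abs h0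
  rcases h1.eq_or_lt with h | h
  · exact hA.2 i j h.symm
  · exact (hA.1 i j h).ge

theorem minorCoeff_nonneg {n p : ℕ} {A : Matrix (Fin n) (Fin n) ℝ} (hA : A ∈ tridiagonalNonneg n)
    {r r' : {r : Fin p → Fin n // StrictMono r}} (hr : r ≠ r') : 0 ≤ minorCoeff A r r' := by
  refine Finset.sum_nonneg fun k _ => Finset.sum_nonneg fun l _ => ?_
  split_ifs with h
  · refine nonneg_of_mem_tridiagonalNonneg hA fun e => hr (Subtype.ext ?_)
    rw [← h, ← e, Function.update_eq_self]
  · exact le_rfl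

/-- Tridiagonality closes the system on increasing row sequences: a replacement that is not
increasing has either zero weight (a jump of more than one) or a repeated row, hence zero
determinant. -/
theorem sum_minorCoeff_mul {n p : ℕ} {A : Matrix (Fin n) (Fin n) ℝ} (hA : A ∈ tridiagonalNonneg n)
    (X : Matrix (Fin n) (Fin n) ℝ) (r : {r : Fin p → Fin n // StrictMono r}) (c : Fin p → Fin n) :
    ∑ r' : {r : Fin p → Fin n // StrictMono r}, minorCoeff A r r' * (X.submatrix r'.1 c).det =
      ∑ k, ∑ l, A (r.1 k) l * (X.submatrix (Function.update r.1 k l) c).det := by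
  simp only [minorCoeff, Finset.sum_mul]
  rw [Finset.sum_comm]
  refine Finset.sum_congr rfl fun k _ => ?_
  rw [Finset.sum_comm]
  refine Finset.sum_congr rfl fun l _ => ?_
  by_cases hm : StrictMono (Function.update r.1 k l)
  · rw [Finset.sum_eq_single (⟨_, hm⟩ : {r : Fin p → Fin n // StrictMono r})]
    · simp
    · intro r' _ hr'
      rw [if_neg fun h => hr' (Subtype.ext h.symm), zero_mul]
    · simp
  · have h0 : ∀ r' : {r : Fin p → Fin n // StrictMono r}, Function.update r.1 k l ≠ r'.1 :=
      fun r' h => hm (h ▸ r'.2)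
    simp only [h0, if_false, zero_mul, Finset.sum_const_zero]
    symm
    rcases le_or_gt |((r.1 k : ℕ) : ℤ) - ((l : ℕ) : ℤ)| 1 with h | h
    · obtain ⟨k', hk', e⟩ := (strictMono_update_or_exists_eq r.2 k l h).resolve_left hm
      rw [Matrix.det_zero_of_row_eq hk', mul_zero]
      ext j
      simp [hk', e]
    · rw [hA.1 _ _ h, zero_mul]

/-- Increasing sequences with the same range coincide and give an identity matrix; otherwise some
row is zero. -/
theorem det_submatrix_one_nonneg {n p : ℕ} {r c : Fin p → Fin n} (hr : StrictMono r)
    (hc : StrictMono c) : 0 ≤ ((1 : Matrix (Fin n) (Fin n) ℝ).submatrix r c).det := by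
  by_cases h : ∀ k, ∃ l, c l = r k
  · have hrange : range r = range c := by
      refine eq_of_subset_of_ncard_le ?_ ?_ (toFinite _)
      · rintro _ ⟨k, rfl⟩
        exact h k
      · rw [← image_univ, ← image_univ, ncard_image_of_injective _ hr.injective,
          ncard_image_of_injective _ hc.injective]
    rw [(StrictMono.range_inj hr hc).1 hrange, Matrix.submatrix_one _ hc.injective,
      Matrix.det_one]
    exact zero_le_one
  · push Not at h
    obtain ⟨k, hk⟩ := h
    rw [Matrix.det_eq_zero_of_row_eq_zero k]
    intro j
    simp [(hk j).symm]

theorem IsTransitionMatrix.isTNDS {n : ℕ} {a b : EReal} {A : ℝ → Matrix (Fin n) (Fin n) ℝ}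
    {Φ : ℝ → ℝ → Matrix (Fin n) (Fin n) ℝ} (hΦ : IsTransitionMatrix a b A Φ)
    (hA : IsLocallyEssBounded a b A)
    (hT : ∀ᵐ t ∂(volume.restrict (interval a b)), A t ∈ tridiagonalNonneg n) :
    IsTNDS a b Φ := by
  intro t₀ ht₀ t ht htt p r c hr hc
  obtain ⟨C, hC0, hC⟩ := hA.exists_bound ht₀ ht
  have hT' := ae_interval_iff.1 hT t₀ ht₀ t ht
  have hD := ae_interval_iff.1 (hΦ.hasDerivAt t₀ ht₀) t₀ ht₀ t ht
  refine nonneg_of_linear_system (ι := {r : Fin p → Fin n // StrictMono r}) htt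
    (M := fun t => minorCoeff (A t)) (x := fun t r => ((Φ t t₀).submatrix r.1 c).det)
    (C := p * (n * C)) ?_ ?_ ?_ ?_ ?_ ⟨r, hr⟩
  · exact fun r => AbsolutelyContinuousOnInterval.det fun i j =>
      hΦ.absolutelyContinuous t₀ ht₀ t₀ ht₀ t ht _ _
  · filter_upwards [hC] with s hs hmem
    exact abs_minorCoeff_le (hs (Ioo_subset_Icc_self hmem)) hC0
  · filter_upwards [hT'] with s hs hmem r r'
    exact minorCoeff_nonneg (hs hmem)
  · filter_upwards [hT', hD] with s hs hs' hmem r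
    rw [sum_minorCoeff_mul (hs hmem)]
    simp only [← det_updateRow_submatrix]
    exact hasDerivAt_det (M := fun s => (Φ s t₀).submatrix r.1 c)
      (M' := (A s * Φ s t₀).submatrix r.1 c) fun i j => hs' hmem _ _
  · intro r
    rw [hΦ.initial t₀ ht₀]
    exact det_submatrix_one_nonneg r.2 hc

/-! ### The cocycle identity and necessity. -/

/-- As functions of `s`, both sides solve the same system and agree at `s = t`; uniqueness holds in
both time directions. -/
theorem IsTransitionMatrix.mul_eq {n : ℕ} {a b : EReal} {A : ℝ → Matrix (Fin n) (Fin n) ℝ}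
    {Φ : ℝ → ℝ → Matrix (Fin n) (Fin n) ℝ} (hΦ : IsTransitionMatrix a b A Φ)
    (hA : IsLocallyEssBounded a b A) {s t u : ℝ} (hs : s ∈ interval a b) (ht : t ∈ interval a b)
    (hu : u ∈ interval a b) : Φ s t * Φ t u = Φ s u := by
  have key : ∀ c ∈ interval a b, ∀ d ∈ interval a b, c ≤ d → ∀ j,
      ((fun i => (Φ c t * Φ t u) i j - Φ c u i j) = 0 ↔
        (fun i => (Φ d t * Φ t u) i j - Φ d u i j) = 0) := by
    intro c hc d hd hcd j
    obtain ⟨C, -, hC⟩ := hA.exists_bound hc hd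
    have h1 := ae_interval_iff.1 (hΦ.hasDerivAt t ht) c hc d hd
    have h2 := ae_interval_iff.1 (hΦ.hasDerivAt u hu) c hc d hd
    refine eq_zero_iff_of_linear_system (M := A) (C := C) hcd
      (x := fun v i => (Φ v t * Φ t u) i j - Φ v u i j) (fun i => ?_) ?_ ?_
    · simp only [Matrix.mul_apply]
      refine (AbsolutelyContinuousOnInterval.finsetSum fun l _ => ?_).fun_sub
        (hΦ.absolutelyContinuous u hu c hc d hd i j)
      exact (hΦ.absolutelyContinuous t ht c hc d hd i l).fun_mul
        (absolutelyContinuousOnInterval_const _)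
    · filter_upwards [hC] with v hv hmem
      exact hv (Ioo_subset_Icc_self hmem)
    · filter_upwards [h1, h2] with v hv1 hv2 hmem i
      have h3 : HasDerivAt (fun v => (Φ v t * Φ t u) i j) ((A v * Φ v t * Φ t u) i j) v := by
        simp only [Matrix.mul_apply (N := Φ t u)]
        exact HasDerivAt.fun_sum fun l _ => (hv1 hmem i l).mul_const _
      refine (h3.sub (hv2 hmem i j)).congr_deriv ?_
      simp only [mul_sub, Finset.sum_sub_distrib, Matrix.mul_assoc, ← Matrix.mul_apply]
  have hzero : ∀ j, (fun i => (Φ t t * Φ t u) i j - Φ t u i j) = 0 := fun j => by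
    ext i
    simp [hΦ.initial t ht]
  ext i j
  have : (fun i => (Φ s t * Φ t u) i j - Φ s u i j) = 0 := by
    rcases le_total s t with h | h
    · exact (key s hs t ht h j).2 (hzero j)
    · exact (key t ht s hs h j).1 (hzero j)
  exact sub_eq_zero.1 (congrFun this i)

/-- The exceptional null set of the differential equation depends on the initial time, so one cannot
simply set `t₀ = t`. Fixing one `t₀` and factoring `Φ(s, t) = Φ(s, t₀) Φ(t₀, t)` leaves a single
null set. -/
theorem IsTransitionMatrix.ae_hasDerivAt_diagonal {n : ℕ} {a b : EReal} (hab : a < b)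
    {A : ℝ → Matrix (Fin n) (Fin n) ℝ} {Φ : ℝ → ℝ → Matrix (Fin n) (Fin n) ℝ}
    (hΦ : IsTransitionMatrix a b A Φ) (hA : IsLocallyEssBounded a b A) :
    ∀ᵐ t ∂(volume.restrict (interval a b)), ∀ i j, HasDerivAt (fun s => Φ s t i j) (A t i j) t := by
  obtain ⟨t₀, ht₀⟩ := interval_nonempty hab
  filter_upwards [hΦ.hasDerivAt t₀ ht₀, ae_restrict_mem (isOpen_interval a b).measurableSet]
    with t ht hmem i j
  have h1 : HasDerivAt (fun s => (Φ s t₀ * Φ t₀ t) i j) ((A t * Φ t t₀ * Φ t₀ t) i j) t := by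
    simp only [Matrix.mul_apply (N := Φ t₀ t)]
    exact HasDerivAt.fun_sum fun l _ => (ht i l).mul_const _
  rw [Matrix.mul_assoc, hΦ.mul_eq hA hmem ht₀ hmem, hΦ.initial t hmem, mul_one] at h1
  refine h1.congr_of_eventuallyEq ?_
  filter_upwards [(isOpen_interval a b).mem_nhds hmem] with s hs
  rw [hΦ.mul_eq hA hs ht₀ hmem]

theorem nonneg_of_hasDerivAt_of_eventually_nonneg {f : ℝ → ℝ} {f' t : ℝ} (hf : HasDerivAt f f' t)
    (h0 : f t = 0) (h : ∀ᶠ s in nhdsWithin t (Ioi t), 0 ≤ f s) : 0 ≤ f' := by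
  have h1 := (hasDerivWithinAt_iff_tendsto_slope' (s := Ioi t) (by simp)).1 hf.hasDerivWithinAt
  refine ge_of_tendsto h1 ?_
  filter_upwards [h, self_mem_nhdsWithin] with s hs hst
  rw [slope_def_field, h0, sub_zero]
  exact div_nonneg hs (sub_nonneg.2 (le_of_lt hst))

theorem IsTN.nonneg {n : ℕ} {M : Matrix (Fin n) (Fin n) ℝ} (hM : IsTN M) (i j : Fin n) :
    0 ≤ M i j := by
  simpa using hM 1 (fun _ => i) (fun _ => j) (Subsingleton.strictMono _) (Subsingleton.strictMono _)

theorem IsTN.mul_sub_mul_nonneg {n : ℕ} {M : Matrix (Fin n) (Fin n) ℝ} (hM : IsTN M)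
    {i i' j j' : Fin n} (hi : i < i') (hj : j < j') : 0 ≤ M i j * M i' j' - M i j' * M i' j := by
  have := hM 2 ![i, i'] ![j, j'] (by simp [Fin.strictMono_iff_lt_succ, hi])
    (by simp [Fin.strictMono_iff_lt_succ, hj])
  rw [Matrix.det_fin_two] at this
  simpa using this

theorem mem_tridiagonalNonneg_of_hasDerivAt {n : ℕ} {A : Matrix (Fin n) (Fin n) ℝ}
    {X : ℝ → Matrix (Fin n) (Fin n) ℝ} {t : ℝ} (h1 : X t = 1)
    (hX : ∀ i j, HasDerivAt (fun s => X s i j) (A i j) t)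
    (hTN : ∀ᶠ s in nhdsWithin t (Ioi t), IsTN (X s)) : A ∈ tridiagonalNonneg n := by
  have hoff : ∀ i j, i ≠ j → 0 ≤ A i j := fun i j hij =>
    nonneg_of_hasDerivAt_of_eventually_nonneg (hX i j) (by simp [h1, hij])
      (hTN.mono fun s hs => hs.nonneg i j)
  refine ⟨fun i j hij => ?_, fun i j hij => hoff i j ?_⟩
  · have hne : i ≠ j := by rintro rfl; simp at hij
    refine le_antisymm ?_ (hoff i j hne)
    obtain ⟨k, hk⟩ : ∃ k : Fin n, (i < k ∧ k < j) ∨ (j < k ∧ k < i) := by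
      rcases lt_abs.1 hij with h | h
      · exact ⟨⟨j + 1, by omega⟩, Or.inr ⟨Fin.lt_def.2 (by simp), Fin.lt_def.2 (by simp; omega)⟩⟩
      · exact ⟨⟨i + 1, by omega⟩, Or.inl ⟨Fin.lt_def.2 (by simp), Fin.lt_def.2 (by simp; omega)⟩⟩
    have hik : i ≠ k := by rcases hk with h | h; exacts [h.1.ne, h.2.ne']
    have hkj : k ≠ j := by rcases hk with h | h; exacts [h.2.ne, h.1.ne']
    -- At the identity the product rule leaves only `-A i j`. The expression is a minor for either
    -- order of `i` and `j`: rows `i, k` and columns `k, j`, or rows `k, i` and columns `j, k`.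
    have hd := ((hX i k).fun_mul (hX k j)).fun_sub ((hX i j).fun_mul (hX k k))
    have := nonneg_of_hasDerivAt_of_eventually_nonneg hd (by simp [h1, hik, hne])
      (hTN.mono fun s hs => by
        rcases hk with h | h
        · exact hs.mul_sub_mul_nonneg h.1 h.2
        · have := hs.mul_sub_mul_nonneg h.2 h.1
          linarith)
    simpa [h1, hik, hkj, hne] using this
  · rintro rfl
    simp at hij

theorem IsTNDS.ae_mem_tridiagonalNonneg {n : ℕ} {a b : EReal} (hab : a < b)
    {A : ℝ → Matrix (Fin n) (Fin n) ℝ} {Φ : ℝ → ℝ → Matrix (Fin n) (Fin n) ℝ}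
    (hTN : IsTNDS a b Φ) (hΦ : IsTransitionMatrix a b A Φ) (hA : IsLocallyEssBounded a b A) :
    ∀ᵐ t ∂(volume.restrict (interval a b)), A t ∈ tridiagonalNonneg n := by
  filter_upwards [hΦ.ae_hasDerivAt_diagonal hab hA,
    ae_restrict_mem (isOpen_interval a b).measurableSet] with t ht hmem
  refine mem_tridiagonalNonneg_of_hasDerivAt (X := fun s => Φ s t) (hΦ.initial t hmem) ht ?_
  filter_upwards [self_mem_nhdsWithin,
    nhdsWithin_le_nhds ((isOpen_interval a b).mem_nhds hmem)] with s hst hs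
  exact hTN t hmem s hs (le_of_lt hst)

end TotallyNonnegative

theorem mainTheorem3 (n : ℕ) (a b : EReal) (hab : a < b)
    (A : ℝ → Matrix (Fin n) (Fin n) ℝ)
    (hA : TotallyNonnegative.IsLocallyEssBounded a b A) :
    (∃ Φ : ℝ → ℝ → Matrix (Fin n) (Fin n) ℝ,
      TotallyNonnegative.IsTransitionMatrix a b A Φ) ∧
    ∀ Φ : ℝ → ℝ → Matrix (Fin n) (Fin n) ℝ,
      TotallyNonnegative.IsTransitionMatrix a b A Φ →
      (TotallyNonnegative.IsTNDS a b Φ ↔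
        ∀ᵐ t ∂(volume.restrict (TotallyNonnegative.interval a b)),
          A t ∈ TotallyNonnegative.tridiagonalNonneg n) :=
  ⟨TotallyNonnegative.exists_isTransitionMatrix hA, fun _ hΦ =>
    ⟨fun h => h.ae_mem_tridiagonalNonneg hab hΦ hA, hΦ.isTNDS hA⟩⟩
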